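/- Let $p$ be a prime. A finite group $G$ with derived subgroup $G'$ is called a Camina group if for every $g \in G \setminus G'$ the conjugacy class of $g$ is the coset $gG'$; a Camina $p$-group is a Camina group that is a finite $p$-group. Let $G$ be a Camina $p$-group of nilpotence class $3$, and put $G_3 = [G',G]$. For every subgroup $N \le G_3$ with $|G_3:N| = p$ (such an $N$ is central, hence normal, in $G$) let $C(N)$ be the subgroup of $G$ containing $N$ with $C(N)/N = C_{G/N}(G'/N)$, and let $\mathcal{C}(G) = \{\, C(N) : N \le G_3,\ |G_3:N| = p \,\}$. Suppose that $C_G(G') = G'$. If $|\mathcal{C}(G)| \le p^a + 1$ for some integer $a \ge 1$, then $|G_3| \le p^{2a}$. -/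

import Mathlib

/-- `G` is a Camina group: the conjugacy class of every `g ∈ G \ G'` is the coset `g G'`. -/
def IsCaminaGroup (G : Type*) [Group G] : Prop :=
  ∀ g : G, g ∉ commutator G → conjugatesOf g = {x : G | ∃ z ∈ commutator G, x = g * z}

/-- The third term `G_3 = [G', G]` of the lower central series `G = G_1 ≥ G' = G_2 ≥ G_3 ≥ ⋯`. -/
def thirdLCS (G : Type*) [Group G] : Subgroup G := ⁅commutator G, (⊤ : Subgroup G)⁆

/-- For a normal subgroup `N`, the subgroup `C(N) ≥ N` determined by
`C(N) / N = C_{G/N}(G' N / N)`, as the preimage in `G` of this centralizer. -/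
def centralizerMod {G : Type*} [Group G] (N : Subgroup G) [N.Normal] : Subgroup G :=
  (Subgroup.centralizer
    ((commutator G).map (QuotientGroup.mk' N) : Set (G ⧸ N))).comap (QuotientGroup.mk' N)

/-- If `G` has nilpotence class `3`, all subgroups of `G_3` are central, hence normal. -/
theorem normal_of_le_thirdLCS {G : Type*} [Group G] (h : Group.nilpotencyClass G = 3)
    {N : Subgroup G} (hN : N ≤ thirdLCS G) : N.Normal := by
  have hG : Group.IsNilpotent G := by
    by_contra hG
    rw [Group.nilpotencyClass_of_not_nilpotent hG] at h
    omega
  have h3 : ⁅thirdLCS G, (⊤ : Subgroup G)⁆ = ⊥ := by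
    have := Subgroup.lowerCentralSeries_nilpotencyClass (G := G)
    rw [h] at this
    exact this
  refine ⟨fun n hn g => ?_⟩
  have hc :=
    Subgroup.commutator_mem_commutator (hN hn) (Subgroup.mem_top g)
  rw [h3, Subgroup.mem_bot, commutatorElement_eq_one_iff_mul_comm] at hc
  rwa [← hc, mul_inv_cancel_right]

/-- `𝒞(G)`, the set of the subgroups `C(N)`, where `N` runs over the subgroups of `G_3` of
index `p` in `G_3`. The normality of `N`, needed to form `G ⧸ N`, is automatic when `G` has
nilpotence class `3`, by `normal_of_le_thirdLCS`. -/
def centralizerFamily (G : Type*) [Group G] (p : ℕ) : Set (Subgroup G) :=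
  {C | ∃ (N : Subgroup G) (_ : N.Normal),
    N ≤ thirdLCS G ∧ N.relIndex (thirdLCS G) = p ∧ C = centralizerMod N}

/-! Dualise over the field of `p` elements. Let `V = G/G'`, and let `L` and `K` be the spaces of
homomorphisms to `ZMod p` from `G'/G₃` and from `G₃`. The sections `V` and `G₃` are elementary
abelian, so `|G₃| ≤ p ^ dim K`. Each `φ` in `L` gives the alternating form `φ ⁅x, y⁆` on `V`, and
the Camina condition makes it nondegenerate for `φ ≠ 0`. The Pfaffian of the generic form is a
polynomial in `dim L` variables of degree at most `dim V / 2` without a nontrivial zero, so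
Chevalley–Warning forces `2 dim L ≤ dim V`.

For `l ≠ 0` in `K`, the subgroup `C(ker l)` has image `C_l = {x | l ⁅w, x⁆ = 0 for all w ∈ G'}` in
`V`. By Hall–Witt `C_l` is totally isotropic for some nondegenerate form, so `2 dim C_l ≤ dim V`;
rank–nullity and the bound on `L` give the reverse inequality. Since all `C_l` have the same
dimension, an inclusion between two of them is an equality. Hence the sets `{m | C_l ≤ ker (T.flip
m)}` are subspaces of `K` meeting pairwise in `0`, one for each distinct `C_l`, and they cover `K`.
The hypothesis on the centralizer of `G'` makes them proper, and a partition of `K` into at most `p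
^ a + 1` proper subspaces requires `dim K ≤ 2a`. -/

/-! ### Alternating forms over a finite field -/

open Module in
/-- The determinant of an alternating matrix over a field is a square. -/
theorem Matrix.isSquare_det_of_alternating {K : Type*} [Field K] :
    ∀ (n : ℕ) {ι : Type*} [Fintype ι] [DecidableEq ι], Fintype.card ι = n →
      ∀ A : Matrix ι ι K, A.transpose = -A → (∀ i, A i i = 0) → IsSquare A.det := by
  intro n
  induction n using Nat.strong_induction_on with
  | _ n ih =>
    intro ι _ _ hn A hA hd
    by_cases h0 : A = 0
    · rcases isEmpty_or_nonempty ι with h | h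
      · simp
      · simp [h0, Matrix.det_zero]
    obtain ⟨i, j, hij⟩ : ∃ i j, A i j ≠ 0 := by
      by_contra! h
      exact h0 (Matrix.ext h)
    have hne : i ≠ j := fun h => hij (h ▸ hd i)
    have hanti : ∀ k l, A l k = -A k l := fun k l => congrFun (congrFun hA k) l
    -- Reorder the basis so that a pair with nonzero pairing comes first and spans a hyperbolic
    -- plane to split off.
    let e : Fin 2 ⊕ {k // k ≠ i ∧ k ≠ j} ≃ ι := by
      refine Equiv.ofBijective (Sum.elim ![i, j] Subtype.val) ⟨?_, ?_⟩
      · rintro (a | ⟨a, ha⟩) (b | ⟨b, hb⟩) h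
        · fin_cases a <;> fin_cases b
          exacts [rfl, absurd h hne, absurd h hne.symm, rfl]
        · fin_cases a
          exacts [absurd h.symm hb.1, absurd h.symm hb.2]
        · fin_cases b
          exacts [absurd h ha.1, absurd h ha.2]
        · simpa using h
      · intro k
        by_cases hi : k = i
        · exact ⟨Sum.inl 0, hi.symm⟩
        by_cases hj : k = j
        · exact ⟨Sum.inl 1, hj.symm⟩
        exact ⟨Sum.inr ⟨k, hi, hj⟩, rfl⟩
    rw [← Matrix.det_submatrix_equiv_self e A, ← Matrix.fromBlocks_toBlocks (A.submatrix e e)]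
    set P := (A.submatrix e e).toBlocks₁₁
    set Q := (A.submatrix e e).toBlocks₁₂
    set R := (A.submatrix e e).toBlocks₂₁
    set S := (A.submatrix e e).toBlocks₂₂
    have hP : P = !![0, A i j; -A i j, 0] := by
      ext a b
      fin_cases a <;> fin_cases b
      exacts [hd i, rfl, hanti i j, hd j]
    have hPdet : P.det = A i j * A i j := by rw [hP, Matrix.det_fin_two_of]; ring
    have hPu : IsUnit P := by
      rw [Matrix.isUnit_iff_isUnit_det, hPdet]
      exact (mul_ne_zero hij hij).isUnit
    have hPT : P.transpose = -P := by
      ext a b; simp [P, Matrix.toBlocks₁₁, hanti (e (Sum.inl a)) (e (Sum.inl b))]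
    have hQT : Q.transpose = -R := by
      ext a b
      simp [Q, R, Matrix.toBlocks₁₂, Matrix.toBlocks₂₁,
        hanti (e (Sum.inr a)) (e (Sum.inl b))]
    have hST : S.transpose = -S := by
      ext a b; simp [S, Matrix.toBlocks₂₂, hanti (e (Sum.inr a)) (e (Sum.inr b))]
    have hRT : R.transpose = -Q := by
      rw [← neg_neg R, ← hQT]; simp
    let _ : Invertible P := hPu.invertible
    -- The determinant is that of `P`, a square, times that of the Schur complement, which is again
    -- alternating and smaller.
    rw [Matrix.det_fromBlocks₁₁, hPdet]
    refine IsSquare.mul ⟨_, rfl⟩ (ih _ ?_ rfl _ ?_ ?_)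
    · rw [← hn]
      exact Fintype.card_subtype_lt (x := i) (by simp)
    · have hPi : (P⁻¹).transpose = -P⁻¹ := by
        rw [Matrix.transpose_nonsing_inv, hPT]
        refine Matrix.inv_eq_left_inv ?_
        rw [neg_mul_neg, Matrix.nonsing_inv_mul _ ((Matrix.isUnit_iff_isUnit_det _).1 hPu)]
      rw [Matrix.invOf_eq_nonsing_inv, Matrix.transpose_sub, Matrix.transpose_mul,
        Matrix.transpose_mul, hST, hQT, hRT, hPi]
      simp [Matrix.mul_assoc]
      abel
    -- Skew-symmetry does not give a zero diagonal in characteristic 2; the explicit inverse of `P`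
    -- does.
    · intro a
      have hPi : ⅟P = !![0, -(A i j)⁻¹; (A i j)⁻¹, 0] := by
        refine invOf_eq_right_inv ?_
        rw [hP]
        ext a b
        fin_cases a <;> fin_cases b <;> simp [Matrix.mul_apply, Fin.sum_univ_two, hij]
      have hRQ : ∀ c, R a c = -Q c a := fun c => by
        have := congrFun (congrFun hQT a) c
        rw [Matrix.transpose_apply] at this
        rw [this]; simp
      rw [hPi]
      simp only [Matrix.sub_apply, Matrix.mul_apply, Fin.sum_univ_two, hRQ]
      simp [S, Matrix.toBlocks₂₂, hd]
      ring

theorem Matrix.totalDegree_det_le {σ R ι : Type*} [CommRing R] [Fintype ι] [DecidableEq ι]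
    (A : Matrix ι ι (MvPolynomial σ R)) (h : ∀ i j, (A i j).totalDegree ≤ 1) :
    A.det.totalDegree ≤ Fintype.card ι := by
  rw [Matrix.det_apply]
  refine MvPolynomial.totalDegree_finsetSum_le fun τ _ => ?_
  refine (MvPolynomial.totalDegree_smul_le _ _).trans ?_
  refine (MvPolynomial.totalDegree_finsetProd _ _).trans ?_
  refine (Finset.sum_le_sum fun i _ => h (τ i) i).trans ?_
  simp

open Module in
/-- A linear space of alternating forms, all nonzero members of which are nondegenerate, on a
nonzero space `V` over a finite field, has dimension at most `dim V / 2`. -/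
theorem two_mul_finrank_le_of_nondegenerate {F V L : Type*} [Field F] [Finite F]
    [AddCommGroup V] [Module F V] [FiniteDimensional F V] [Nontrivial V]
    [AddCommGroup L] [Module F L] [FiniteDimensional F L]
    (β : V →ₗ[F] V →ₗ[F] L →ₗ[F] F) (halt : ∀ x, β x x = 0)
    (hnd : ∀ φ, φ ≠ 0 → ∀ x, (∀ y, β x y φ = 0) → x = 0) :
    2 * finrank F L ≤ finrank F V := by
  classical
  cases nonempty_fintype F
  by_contra! hlt
  let b := finBasis F V
  let c := finBasis F L
  have hskew : ∀ x y, β y x = -β x y := fun x y => by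
    have h := halt (x + y)
    simp only [map_add, LinearMap.add_apply, halt, zero_add, add_zero] at h
    rw [eq_neg_iff_add_eq_zero, h]
  -- Gram matrix of the generic form: the variables are coordinates on `L`.
  let A : Matrix (Fin (finrank F V)) (Fin (finrank F V)) (MvPolynomial (Fin (finrank F L)) F) :=
    Matrix.of fun i k => ∑ j, MvPolynomial.C (β (b i) (b k) (c j)) * MvPolynomial.X j
  have hAT : A.transpose = -A := by
    ext1 i k
    simp [A, hskew (b i) (b k)]
  have hAd : ∀ i, A i i = 0 := fun i => by simp [A, halt]
  have hdeg : A.det.totalDegree ≤ finrank F V := by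
    refine (Matrix.totalDegree_det_le A fun i k => ?_).trans (by simp)
    refine MvPolynomial.totalDegree_finsetSum_le (s := Finset.univ) (f := fun j =>
      MvPolynomial.C (β (b i) (b k) (c j)) * MvPolynomial.X j) fun j _ => ?_
    refine (MvPolynomial.totalDegree_mul _ _).trans ?_
    rw [MvPolynomial.totalDegree_C, MvPolynomial.totalDegree_X]
  obtain ⟨f, hf⟩ : ∃ f, A.det = f * f := by
    -- The square root found in the fraction field is integral, hence a polynomial: `f` is the
    -- Pfaffian up to sign.
    let K := FractionRing (MvPolynomial (Fin (finrank F L)) F)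
    let g := algebraMap (MvPolynomial (Fin (finrank F L)) F) K
    obtain ⟨r, hr⟩ := Matrix.isSquare_det_of_alternating (K := K) _ rfl (A.map g)
      (by rw [← Matrix.transpose_map, hAT]; ext1; simp) (fun i => by simp [hAd])
    have hr2 : g A.det = r ^ 2 := by rw [RingHom.map_det, pow_two, ← hr]; rfl
    obtain ⟨f, hf⟩ := IsIntegrallyClosed.exists_algebraMap_eq_of_isIntegral_pow
      (R := MvPolynomial (Fin (finrank F L)) F) (x := r) (n := 2) two_pos
      (by rw [← hr2]; exact isIntegral_algebraMap)
    refine ⟨f, IsFractionRing.injective _ K ?_⟩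
    rw [map_mul, hf, ← pow_two]
    exact hr2
  have hfdeg : f.totalDegree < Fintype.card (Fin (finrank F L)) := by
    rw [Fintype.card_fin]
    by_cases h0 : f = 0
    · rw [h0, MvPolynomial.totalDegree_zero]
      omega
    · rw [hf, MvPolynomial.totalDegree_mul_of_isDomain h0 h0] at hdeg
      omega
  have hev : ∀ t, MvPolynomial.eval t A.det =
      (Matrix.of fun i k => β (b i) (b k) (c.equivFun.symm t)).det := fun t => by
    rw [RingHom.map_det]
    congr 1
    ext i k
    simp [A, Basis.equivFun_symm_apply, mul_comm]
  have hpos : 0 < finrank F V := finrank_pos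
  -- The origin is a root because `V ≠ 0` makes the zero matrix nonempty.
  have h0 : MvPolynomial.eval 0 f = 0 := by
    have h := hev 0
    rw [hf, map_mul, map_zero] at h
    have : NeZero (finrank F V) := ⟨hpos.ne'⟩
    have hz : (Matrix.of fun i k => β (b i) (b k) (0 : L)).det = 0 := by
      have : (Matrix.of fun i k => β (b i) (b k) (0 : L)) = 0 := by ext; simp
      rw [this, Matrix.det_zero]
    rw [hz] at h
    exact mul_self_eq_zero.1 h
  obtain ⟨p, hp⟩ := CharP.exists F
  have hpp : p.Prime := (CharP.char_is_prime_or_zero F p).resolve_right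
    (CharP.char_ne_zero_of_finite F p)
  -- Chevalley–Warning: the number of roots is divisible by `p`, so there is a root besides the
  -- origin, that is, a nonzero degenerate form.
  have hdvd := char_dvd_card_solutions p hfdeg
  have hone : 1 < Fintype.card {x // MvPolynomial.eval x f = 0} :=
    hpp.one_lt.trans_le (Nat.le_of_dvd (Fintype.card_pos_iff.2 ⟨⟨0, h0⟩⟩) hdvd)
  obtain ⟨⟨t, ht⟩, hne⟩ := Fintype.exists_ne_of_one_lt_card hone ⟨0, h0⟩
  have ht0 : t ≠ 0 := fun h => hne (Subtype.ext h)
  have hdet := hev t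
  rw [hf, map_mul, ht, mul_zero] at hdet
  obtain ⟨v, hv, hv0⟩ := Matrix.exists_vecMul_eq_zero_iff.2 hdet.symm
  refine hv ?_
  have hx : b.equivFun.symm v = 0 := by
    refine hnd (c.equivFun.symm t) 
      ((LinearEquiv.map_ne_zero_iff _).2 ht0) _ fun y => ?_
    have : (LinearMap.applyₗ (c.equivFun.symm t)).comp (β (b.equivFun.symm v)) = 0 := by
      refine b.ext fun k => ?_
      have h := congrFun hv0 k
      rw [Matrix.vecMul, dotProduct] at h
      rw [Basis.equivFun_symm_apply b]
      simpa only [map_sum, map_smul, LinearMap.comp_apply, LinearMap.sum_apply,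
        LinearMap.smul_apply, LinearMap.zero_apply, LinearMap.applyₗ_apply_apply,
        smul_eq_mul, Matrix.of_apply, Pi.zero_apply] using h
    exact LinearMap.congr_fun this y
  exact (LinearEquiv.map_eq_zero_iff _).1 hx

/-! ### Partitions of a vector space into subspaces -/

open Module in
/-- If the nonzero vectors of a finite vector space are partitioned by `q ^ a + 1` or fewer proper
subspaces, then its dimension is at most `2 * a`. -/
theorem finrank_le_two_mul_of_partition {F K : Type*} [Field F] [Finite F]
    [AddCommGroup K] [Module F K] [FiniteDimensional F K] (P : Finset (Submodule F K))
    (hcov : ∀ x : K, x ≠ 0 → ∃ U ∈ P, x ∈ U)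
    (hdisj : ∀ U ∈ P, ∀ U' ∈ P, U ≠ U' → Disjoint U U') (htop : ⊤ ∉ P) (a : ℕ)
    (hcard : P.card ≤ Nat.card F ^ a + 1) : finrank F K ≤ 2 * a := by
  classical
  rcases subsingleton_or_nontrivial K with hK | hK
  · simp [finrank_zero_of_subsingleton]
  cases nonempty_fintype F
  have : Finite K := Module.finite_of_finite F
  cases nonempty_fintype K
  obtain ⟨x, hx⟩ := exists_ne (0 : K)
  obtain ⟨U₀, hU₀, -⟩ := hcov x hx
  obtain ⟨X, hXP, hX⟩ := P.exists_max_image (fun U => finrank F U) ⟨U₀, hU₀⟩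
  set q := Nat.card F with hq
  have hq2 : 2 ≤ q := Finite.one_lt_card
  set m := finrank F K with hm
  set d := finrank F X with hd
  have hdm : d < m := Submodule.finrank_lt (fun h => htop (h ▸ hXP))
  have hsub : ∀ U : Submodule F K,
      (Finset.univ.filter (· ∈ U)).card = q ^ finrank F U := fun U => by
    rw [hq, Nat.card_eq_fintype_card, ← Module.card_eq_pow_finrank (K := F) (V := U),
      Fintype.card_subtype]
  -- Every other part has dimension at most `d` by maximality of `X`, and at most `m - d` since it
  -- meets `X` trivially.
  have hcount : q ^ m ≤ q ^ d + q ^ a * (q ^ min d (m - d) - 1) := by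
    calc q ^ m = (Finset.univ : Finset K).card := by
          rw [Finset.card_univ, Module.card_eq_pow_finrank (K := F), hq, Nat.card_eq_fintype_card]
      _ ≤ ((Finset.univ.filter (· ∈ X)) ∪
            (P.erase X).biUnion fun U => (Finset.univ.filter (· ∈ U)).erase 0).card := by
          refine Finset.card_le_card fun y _ => ?_
          by_cases hy : y ∈ X
          · simp [hy]
          obtain ⟨U, hU, hyU⟩ := hcov y (fun h => hy (h ▸ X.zero_mem))
          refine Finset.mem_union_right _ (Finset.mem_biUnion.2 ⟨U, ?_, ?_⟩)
          · exact Finset.mem_erase.2 ⟨fun h => hy (h ▸ hyU), hU⟩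
          · exact Finset.mem_erase.2 ⟨fun h => hy (h ▸ X.zero_mem), by simpa using hyU⟩
      _ ≤ q ^ d + ∑ U ∈ P.erase X, ((Finset.univ.filter (· ∈ U)).erase 0).card :=
          (Finset.card_union_le _ _).trans
            (add_le_add (hsub X).le Finset.card_biUnion_le)
      _ ≤ q ^ d + ∑ U ∈ P.erase X, (q ^ min d (m - d) - 1) := by
          refine Nat.add_le_add_left (Finset.sum_le_sum fun U hU => ?_) _
          obtain ⟨hUX, hUP⟩ := Finset.mem_erase.1 hU
          rw [Finset.card_erase_of_mem (by simp), hsub]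
          refine Nat.sub_le_sub_right (Nat.pow_le_pow_right (by omega) (le_min (hX U hUP) ?_)) 1
          have h := Submodule.finrank_sup_add_finrank_inf_eq U X
          rw [(hdisj U hUP X hXP hUX).eq_bot, finrank_bot] at h
          have := Submodule.finrank_le (U ⊔ X)
          omega
      _ ≤ q ^ d + q ^ a * (q ^ min d (m - d) - 1) := by
          rw [Finset.sum_const, smul_eq_mul, Finset.card_erase_of_mem hXP]
          exact Nat.add_le_add_left (Nat.mul_le_mul_right _ (by omega)) _
  by_contra! hlt
  rcases le_or_gt (m - d) d with hmd | hmd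
  -- Here `d > a`, so `q ^ m - q ^ d = q ^ d * (q ^ (m - d) - 1)` exceeds the count.
  · rw [min_eq_right hmd] at hcount
    have h1 : q ^ a < q ^ d := Nat.pow_lt_pow_right (by omega) (by omega)
    have h2 : 1 < q ^ (m - d) := Nat.one_lt_pow (by omega) (by omega)
    have h3 : q ^ m = q ^ d * q ^ (m - d) := by rw [← pow_add]; congr 1; omega
    have h4 := Nat.mul_lt_mul_of_pos_right h1 (Nat.sub_pos_of_lt h2)
    have h5 : q ^ d * (q ^ (m - d) - 1) = q ^ d * q ^ (m - d) - q ^ d := by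
      rw [Nat.mul_sub, mul_one]
    have h6 : q ^ d ≤ q ^ d * q ^ (m - d) := Nat.le_mul_of_pos_right _ (by omega)
    omega
  -- Here `d` and `a + d` are at most `m - 1`; the subtracted `q ^ a` makes the bound strictly less
  -- than `2 * q ^ (m - 1) ≤ q ^ m`.
  · rw [min_eq_left hmd.le, Nat.mul_sub, mul_one, ← pow_add] at hcount
    have h1 : q ^ (a + d) ≤ q ^ (m - 1) := Nat.pow_le_pow_right (by omega) (by omega)
    have h2 : q ^ d ≤ q ^ (m - 1) := Nat.pow_le_pow_right (by omega) (by omega)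
    have h3 : 0 < q ^ a := by positivity
    have h5 : 0 < q ^ d := by positivity
    have h4 : q ^ m = q ^ (m - 1) * q := by rw [← pow_succ]; congr 1; omega
    have h6 := Nat.mul_le_mul_left (q ^ (m - 1)) hq2
    omega

/-! ### The linear model -/

open Module in
/-- Linear algebra of Camina groups of class `3`: `β` models the commutator on `G / G'` with values
in `G' / G₃`, and `T` the commutator of `G / G'` and `G' / G₃`, with values in `G₃`. -/
theorem finrank_le_two_mul_of_ncard_ker_le {F V L K : Type*} [Field F] [Finite F]
    [AddCommGroup V] [Module F V] [FiniteDimensional F V]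
    [AddCommGroup L] [Module F L] [FiniteDimensional F L]
    [AddCommGroup K] [Module F K] [FiniteDimensional F K]
    (β : V →ₗ[F] V →ₗ[F] L →ₗ[F] F) (halt : ∀ x, β x x = 0)
    (hnd : ∀ φ, φ ≠ 0 → ∀ x, (∀ y, β x y φ = 0) → x = 0)
    (T : V →ₗ[F] K →ₗ[F] L)
    (hHW : ∀ l x y z, β x y (T z l) + β y z (T x l) + β z x (T y l) = 0)
    (hT : ∀ l, (∀ x, T x l = 0) → l = 0) (hc : ∀ x, (∀ l, T x l = 0) → x = 0) (a : ℕ)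
    (hcard : {C : Submodule F V | ∃ l, l ≠ 0 ∧ C = LinearMap.ker (T.flip l)}.ncard ≤
      Nat.card F ^ a + 1) :
    finrank F K ≤ 2 * a := by
  classical
  rcases subsingleton_or_nontrivial V with hV | hV
  · have hK : Subsingleton K := subsingleton_of_forall_eq 0 fun l =>
      hT l fun x => by rw [Subsingleton.elim x 0, map_zero, LinearMap.zero_apply]
    simp [finrank_zero_of_subsingleton]
  have : Finite V := Module.finite_of_finite F
  have hLV : 2 * finrank F L ≤ finrank F V := two_mul_finrank_le_of_nondegenerate β halt hnd
  have hdim : ∀ l, l ≠ 0 → 2 * finrank F (LinearMap.ker (T.flip l)) = finrank F V := by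
    intro l hl
    obtain ⟨z, hz⟩ : ∃ z, T z l ≠ 0 := by
      by_contra! h
      exact hl (hT l h)
    set C := LinearMap.ker (T.flip l) with hC
    have hmem : ∀ {x}, x ∈ C → T x l = 0 := fun {x} hx => hx
    refine le_antisymm ?_ ?_
    -- For `x, y ∈ C` two of the three Hall–Witt terms vanish, so `C` is isotropic for the
    -- nondegenerate form attached to `T z l`.
    · let B : V →ₗ[F] Dual F V := β.compr₂ (LinearMap.applyₗ (T z l))
      have hB : Function.Injective B := (injective_iff_map_eq_zero B).2 fun x hx =>
        hnd _ hz x fun y => LinearMap.congr_fun hx y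
      have hle : C.map B ≤ C.dualAnnihilator := by
        rintro _ ⟨x, hx, rfl⟩
        refine (Submodule.mem_dualAnnihilator _).2 fun y hy => ?_
        have h := hHW l x y z
        rw [hmem hx, hmem hy, map_zero, map_zero, add_zero, add_zero] at h
        exact h
      have h1 := Submodule.finrank_mono hle
      rw [← (Submodule.equivMapOfInjective B hB C).finrank_eq] at h1
      have h2 := Subspace.finrank_add_finrank_dualAnnihilator_eq C
      omega
    -- The range lies in `L`, so `C` has codimension at most `dim L ≤ dim V / 2`.
    · have h1 := LinearMap.finrank_range_add_finrank_ker (T.flip l)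
      have h2 := Submodule.finrank_le (LinearMap.range (T.flip l))
      rw [← hC] at h1
      omega
  have heq : ∀ l m, l ≠ 0 → m ≠ 0 → LinearMap.ker (T.flip l) ≤ LinearMap.ker (T.flip m) →
      LinearMap.ker (T.flip l) = LinearMap.ker (T.flip m) := fun l m hl hm h =>
    Submodule.eq_of_le_of_finrank_eq h (by have := hdim l hl; have := hdim m hm; omega)
  let S : Submodule F V → Submodule F K := fun C => ⨅ x ∈ C, LinearMap.ker (T x)
  have hS : ∀ C l, l ∈ S C ↔ C ≤ LinearMap.ker (T.flip l) := fun C l => by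
    simp [S, Submodule.mem_iInf, SetLike.le_def]
  let 𝒞 := {C : Submodule F V | ∃ l, l ≠ 0 ∧ C = LinearMap.ker (T.flip l)}
  have hfin : 𝒞.Finite := Set.toFinite _
  refine finrank_le_two_mul_of_partition (hfin.toFinset.image S) ?_ ?_ ?_ a
    (Finset.card_image_le.trans ?_)
  · intro l hl
    exact ⟨S (LinearMap.ker (T.flip l)), Finset.mem_image_of_mem _
      (hfin.mem_toFinset.2 ⟨l, hl, rfl⟩), (hS _ _).2 le_rfl⟩
  · simp only [Finset.mem_image, Set.Finite.mem_toFinset]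
    rintro _ ⟨_, ⟨l, hl, rfl⟩, rfl⟩ _ ⟨_, ⟨m, hm, rfl⟩, rfl⟩ hne
    refine Submodule.disjoint_def.2 fun n hn hn' => ?_
    by_contra h0
    exact hne (by rw [heq l n hl h0 ((hS _ _).1 hn), heq m n hm h0 ((hS _ _).1 hn')])
  -- If a part were all of `K`, its kernel would be killed by every `m` and so be zero, yet it has
  -- dimension `dim V / 2 > 0`.
  · simp only [Finset.mem_image, Set.Finite.mem_toFinset]
    rintro ⟨_, ⟨l, hl, rfl⟩, htop⟩
    have hbot : LinearMap.ker (T.flip l) = ⊥ := (Submodule.eq_bot_iff _).2 fun x hx =>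
      hc x fun m => (hS _ _).1 (htop ▸ Submodule.mem_top : m ∈ S _) hx
    have h1 := hdim l hl
    have h2 : 0 < finrank F V := finrank_pos
    rw [hbot, finrank_bot] at h1
    omega
  · rwa [← Set.ncard_eq_toFinset_card 𝒞 hfin]

/-! ### Homomorphisms to `ZMod p` -/

/-- The space of homomorphisms from a group `A` to `ZMod p` that vanish on `N`. -/
def homsVanishingOn {A : Type*} [Group A] (p : ℕ) (N : Subgroup A) :
    Submodule (ZMod p) (A → ZMod p) where
  carrier := {f | (∀ x y, f (x * y) = f x + f y) ∧ ∀ x ∈ N, f x = 0}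
  add_mem' {f g} hf hg := ⟨fun x y => by
      simp only [Pi.add_apply, hf.1, hg.1]; abel,
    fun x hx => by simp [hf.2 x hx, hg.2 x hx]⟩
  zero_mem' := ⟨fun _ _ => by simp, fun _ _ => rfl⟩
  smul_mem' c f hf := ⟨fun x y => by simp [hf.1, mul_add], fun x hx => by simp [hf.2 x hx]⟩

section HomsVanishingOn

variable {A : Type*} [Group A] {p : ℕ} {N : Subgroup A}

theorem homsVanishingOn.map_mul (f : homsVanishingOn p N) (x y : A) :
    f.1 (x * y) = f.1 x + f.1 y := f.2.1 x y

theorem homsVanishingOn.map_one (f : homsVanishingOn p N) : f.1 1 = 0 := f.2.2 1 N.one_mem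

/-- An element of `homsVanishingOn p N` as a bundled homomorphism. -/
def homsVanishingOn.toHom (f : homsVanishingOn p N) : A →* Multiplicative (ZMod p) where
  toFun x := Multiplicative.ofAdd (f.1 x)
  map_one' := by rw [homsVanishingOn.map_one f]; rfl
  map_mul' x y := by rw [homsVanishingOn.map_mul f]; rfl

theorem homsVanishingOn.index_ker_toHom (hp : p.Prime) (f : homsVanishingOn p N) (hf : f ≠ 0) :
    (homsVanishingOn.toHom f).ker.index = p := by
  have hcard : Nat.card (Multiplicative (ZMod p)) = p := by
    rw [Nat.card_congr Multiplicative.toAdd, Nat.card_zmod]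
  have : Fact (Nat.card (Multiplicative (ZMod p))).Prime := ⟨by rwa [hcard]⟩
  rw [Subgroup.index_ker]
  rcases (homsVanishingOn.toHom f).range.eq_bot_or_eq_top_of_prime_card with h | h
  · refine absurd (Subtype.ext (funext fun x => ?_)) hf
    have hx : (homsVanishingOn.toHom f) x ∈ (homsVanishingOn.toHom f).range := ⟨x, rfl⟩
    rw [h, Subgroup.mem_bot] at hx
    exact hx
  · rw [h, Subgroup.card_top, hcard]

end HomsVanishingOn

section Elementary

variable {A : Type*} [CommGroup A] {p : ℕ}

open Module in
theorem card_le_pow_finrank_homsVanishingOn_bot [Finite A] (hp : p.Prime)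
    (hA : ∀ x : A, x ^ p = 1) :
    Nat.card A ≤ p ^ finrank (ZMod p) (homsVanishingOn p (⊥ : Subgroup A)) := by
  have : Fact p.Prime := ⟨hp⟩
  let _ : Module (ZMod p) (Additive A) := AddCommGroup.zmodModule (n := p) fun x => hA x.toMul
  have : Finite (Additive A) := ‹Finite A›
  let φ : Dual (ZMod p) (Additive A) →ₗ[ZMod p] homsVanishingOn p (⊥ : Subgroup A) :=
    { toFun := fun f => ⟨fun x => f (Additive.ofMul x), fun x y => f.map_add _ _, by
        rintro x rfl; exact f.map_zero⟩
      map_add' := fun _ _ => rfl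
      map_smul' := fun _ _ => rfl }
  have hφ : Function.Injective φ := fun f g h => LinearMap.ext fun x =>
    congrFun (congrArg Subtype.val h) x.toMul
  have h1 := LinearMap.finrank_le_finrank_of_injective hφ
  rw [Subspace.dual_finrank_eq] at h1
  have h2 : Nat.card A = p ^ finrank (ZMod p) (Additive A) := by
    have := Module.natCard_eq_pow_finrank (K := ZMod p) (V := Additive A)
    rw [Nat.card_zmod] at this
    exact this
  rw [h2]
  exact Nat.pow_le_pow_right hp.pos h1

theorem exists_homsVanishingOn_bot_ne_zero (hp : p.Prime) (hA : ∀ x : A, x ^ p = 1)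
    {x : A} (hx : x ≠ 1) : ∃ f : homsVanishingOn p (⊥ : Subgroup A), f.1 x ≠ 0 := by
  have : Fact p.Prime := ⟨hp⟩
  let _ : Module (ZMod p) (Additive A) := AddCommGroup.zmodModule (n := p) fun x => hA x.toMul
  obtain ⟨f, hf⟩ := Module.Projective.exists_dual_ne_zero (ZMod p)
    (x := Additive.ofMul x) hx
  exact ⟨⟨fun x => f (Additive.ofMul x), fun x y => f.map_add _ _, by
        rintro x rfl; exact f.map_zero⟩, hf⟩

/-- By Cauchy the `p`-th power map is not injective, hence not surjective, and its cokernel is a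
nonzero vector space. This is needed for `G₃` before its exponent is known. -/
theorem exists_ne_zero_homsVanishingOn_bot [Finite A] [Nontrivial A] (hp : p.Prime)
    (hA : IsPGroup p A) : ∃ f : homsVanishingOn p (⊥ : Subgroup A), f ≠ 0 := by
  have : Fact p.Prime := ⟨hp⟩
  obtain ⟨z, hz⟩ := exists_prime_orderOf_dvd_card' (G := A) p
    (hA.card_eq_or_dvd.resolve_left Finite.one_lt_card.ne')
  have hninj : ¬ Function.Injective (powMonoidHom p : A →* A) := fun h => by
    have h1 : z = 1 := h (by simp [← hz, pow_orderOf_eq_one])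
    rw [h1, orderOf_one] at hz
    exact hp.one_lt.ne hz
  rw [Finite.injective_iff_surjective] at hninj
  obtain ⟨x, hx⟩ : ∃ x, x ∉ (powMonoidHom p : A →* A).range := by
    by_contra! h
    exact hninj fun x => h x
  obtain ⟨f, hf⟩ := exists_homsVanishingOn_bot_ne_zero
    (A := A ⧸ (powMonoidHom p : A →* A).range) hp
    (fun y => by
      induction y using QuotientGroup.induction_on with
      | H y =>
        rw [← QuotientGroup.mk_pow, QuotientGroup.eq_one_iff]
        exact ⟨y, rfl⟩)
    (x := QuotientGroup.mk x) (fun h => hx ((QuotientGroup.eq_one_iff x).1 h))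
  refine ⟨⟨fun y => f.1 (QuotientGroup.mk y), fun y y' =>
      homsVanishingOn.map_mul f (QuotientGroup.mk y) (QuotientGroup.mk y'), ?_⟩,
    fun h => hf ?_⟩
  · rintro y rfl
    exact homsVanishingOn.map_one f
  · exact congrFun (congrArg Subtype.val h) x

end Elementary

/-! ### Descent to the abelianization -/

section Abelianization

variable {G : Type*} [Group G] {p : ℕ}

/-- The class of a group element in the abelianization, written additively. -/
def toAbelianization (x : G) : Additive (Abelianization G) := Additive.ofMul (Abelianization.of x)

theorem toAbelianization_surjective :
    Function.Surjective (toAbelianization : G → Additive (Abelianization G)) := fun v =>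
  QuotientGroup.mk_surjective v.toMul

theorem toAbelianization_inv (x : G) :
    toAbelianization x⁻¹ = -toAbelianization x := rfl

theorem toAbelianization_eq_zero_iff {x : G} : toAbelianization x = 0 ↔ x ∈ commutator G :=
  QuotientGroup.eq_one_iff x

/-- An additive function on `G` descends to a linear map on the abelianization. -/
theorem exists_linearMap_toAbelianization [Module (ZMod p) (Additive (Abelianization G))]
    {M : Type*} [AddCommGroup M] [Module (ZMod p) M] (f : G → M)
    (hf : ∀ x y, f (x * y) = f x + f y) :
    ∃ g : Additive (Abelianization G) →ₗ[ZMod p] M, ∀ x, g (toAbelianization x) = f x := by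
  let f' : G →* Multiplicative M := MonoidHom.mk' (fun x => Multiplicative.ofAdd (f x))
    fun x y => by rw [hf]; rfl
  let g : Additive (Abelianization G) →+ M :=
    MonoidHom.toAdditiveLeft (Abelianization.lift f')
  exact ⟨g.toZModLinearMap p, fun x => rfl⟩

theorem exists_bilinearMap_toAbelianization [Module (ZMod p) (Additive (Abelianization G))]
    {M : Type*} [AddCommGroup M] [Module (ZMod p) M] (f : G → G → M)
    (hl : ∀ x y z, f (x * y) z = f x z + f y z) (hr : ∀ x y z, f x (y * z) = f x y + f x z) :
    ∃ g : Additive (Abelianization G) →ₗ[ZMod p] Additive (Abelianization G) →ₗ[ZMod p] M,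
      ∀ x y, g (toAbelianization x) (toAbelianization y) = f x y := by
  choose h hh using fun x => exists_linearMap_toAbelianization (p := p) (f x) (hr x)
  obtain ⟨g, hg⟩ := exists_linearMap_toAbelianization (p := p) h fun x y => by
    ext v
    obtain ⟨v, rfl⟩ := toAbelianization_surjective v
    rw [LinearMap.add_apply, hh, hh, hh, hl]
  exact ⟨g, fun x y => by rw [hg, hh]⟩

end Abelianization

open scoped commutatorElement

/-! ### Commutator calculus with central `G₃` -/

section Class3

variable {G : Type*} [Group G] {p : ℕ}

/-- The commutator of two elements, as an element of the derived subgroup. -/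
def derivedCommutator (x y : G) : commutator G :=
  ⟨⁅x, y⁆, Subgroup.commutator_mem_commutator (Subgroup.mem_top x) (Subgroup.mem_top y)⟩

/-- The commutator of an element of the derived subgroup with any element. -/
def thirdCommutator (w : commutator G) (x : G) : thirdLCS G :=
  ⟨⁅(w : G), x⁆, Subgroup.commutator_mem_commutator w.2 (Subgroup.mem_top x)⟩

theorem thirdLCS_le_commutator : thirdLCS G ≤ commutator G :=
  Subgroup.commutator_mono le_top le_rfl

theorem derivedCommutator_mem_thirdLCS {w : G} (hw : w ∈ commutator G) (x : G) :
    (derivedCommutator w x : G) ∈ thirdLCS G :=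
  Subgroup.commutator_mem_commutator hw (Subgroup.mem_top x)

/-- The homomorphisms from `G'` to `ZMod p` that vanish on `G₃`. -/
abbrev derivedHoms (G : Type*) [Group G] (p : ℕ) :
    Submodule (ZMod p) (commutator G → ZMod p) :=
  homsVanishingOn p ((thirdLCS G).subgroupOf (commutator G))

/-- The homomorphisms from `G₃` to `ZMod p`. -/
abbrev thirdHoms (G : Type*) [Group G] (p : ℕ) : Submodule (ZMod p) (thirdLCS G → ZMod p) :=
  homsVanishingOn p (⊥ : Subgroup (thirdLCS G))

theorem derivedHoms_apply_conj (φ : derivedHoms G p) (x : G) (w : commutator G)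
    (h : x * w * x⁻¹ ∈ commutator G) : φ.1 ⟨x * w * x⁻¹, h⟩ = φ.1 w := by
  have hmem : ⁅x, (w : G)⁆ ∈ thirdLCS G := by
    rw [← commutatorElement_inv]
    exact inv_mem (Subgroup.commutator_mem_commutator w.2 (Subgroup.mem_top x))
  have heq : (⟨x * w * x⁻¹, h⟩ : commutator G) =
      ⟨⁅x, (w : G)⁆, thirdLCS_le_commutator hmem⟩ * w := by
    ext
    simp [commutatorElement_def]
  rw [heq, homsVanishingOn.map_mul, φ.2.2 _ hmem, zero_add]

theorem derivedHoms_mul_left (φ : derivedHoms G p) (x y z : G) :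
    φ.1 (derivedCommutator (x * y) z) =
      φ.1 (derivedCommutator x z) + φ.1 (derivedCommutator y z) := by
  have h : x * (derivedCommutator y z : G) * x⁻¹ ∈ commutator G :=
    Subgroup.Normal.conj_mem inferInstance _ (derivedCommutator y z).2 x
  have heq : derivedCommutator (x * y) z =
      ⟨x * (derivedCommutator y z : G) * x⁻¹, h⟩ * derivedCommutator x z :=
    Subtype.ext (commutatorElement_mul_left_eq_conj_mul x y z)
  rw [heq, homsVanishingOn.map_mul, derivedHoms_apply_conj, add_comm]

theorem derivedHoms_mul_right (φ : derivedHoms G p) (x y z : G) :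
    φ.1 (derivedCommutator x (y * z)) =
      φ.1 (derivedCommutator x y) + φ.1 (derivedCommutator x z) := by
  have h : y * (derivedCommutator x z : G) * y⁻¹ ∈ commutator G :=
    Subgroup.Normal.conj_mem inferInstance _ (derivedCommutator x z).2 y
  have heq : derivedCommutator x (y * z) =
      derivedCommutator x y * ⟨y * (derivedCommutator x z : G) * y⁻¹, h⟩ :=
    Subtype.ext (by simp [derivedCommutator, commutatorElement_def, mul_assoc])
  rw [heq, homsVanishingOn.map_mul, derivedHoms_apply_conj]

theorem derivedHoms_self (φ : derivedHoms G p) (x : G) :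
    φ.1 (derivedCommutator x x) = 0 := by
  have : derivedCommutator x x = 1 := Subtype.ext (commutatorElement_self x)
  rw [this, homsVanishingOn.map_one]

theorem derivedHoms_one_left (φ : derivedHoms G p) (y : G) :
    φ.1 (derivedCommutator 1 y) = 0 := by
  have : derivedCommutator 1 y = 1 := Subtype.ext (commutatorElement_one_left y)
  rw [this, homsVanishingOn.map_one]

theorem derivedHoms_pow_left (φ : derivedHoms G p) (x y : G) (n : ℕ) :
    φ.1 (derivedCommutator (x ^ n) y) = n * φ.1 (derivedCommutator x y) := by
  induction n with
  | zero => rw [pow_zero, derivedHoms_one_left, Nat.cast_zero, zero_mul]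
  | succ n ih => rw [pow_succ, derivedHoms_mul_left, ih, Nat.cast_succ, add_one_mul]

/-- In a Camina group, nonzero homomorphisms on `G' / G₃` give nondegenerate commutator forms. -/
theorem IsCaminaGroup.mem_commutator_of_derivedHoms (hG : IsCaminaGroup G)
    {φ : derivedHoms G p} (hφ : φ ≠ 0) {x : G} (hx : ∀ y, φ.1 (derivedCommutator x y) = 0) :
    x ∈ commutator G := by
  by_contra hxG
  refine hφ (Subtype.ext (funext fun z => ?_))
  -- The Camina condition writes any `z ∈ G'` as `⁅x⁻¹, y⁆`, and `φ` is zero there since it is zero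
  -- on `⁅x, y⁆`.
  have hmem : x * z ∈ conjugatesOf x := by
    rw [hG x hxG]
    exact ⟨z, z.2, rfl⟩
  obtain ⟨y, hy⟩ := isConj_iff.1 hmem
  have hz : z = derivedCommutator x⁻¹ y := Subtype.ext <| by
    change (z : G) = ⁅x⁻¹, y⁆
    rw [commutatorElement_def, ← mul_right_inj x, ← hy]
    group
  have h := derivedHoms_mul_left φ x⁻¹ x y
  rw [inv_mul_cancel, derivedHoms_one_left, hx, add_zero] at h
  rw [hz]
  exact h.symm

theorem conj_eq_of_central
    (hz : ∀ z ∈ thirdLCS G, ∀ g : G, z * g = g * z)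
    {z : G} (hzm : z ∈ thirdLCS G) (g : G) : g * z * g⁻¹ = z := by
  rw [← hz z hzm g, mul_inv_cancel_right]

theorem thirdCommutator_mul_left
    (hz : ∀ z ∈ thirdLCS G, ∀ g : G, z * g = g * z) (w w' : commutator G) (x : G) :
    thirdCommutator (w * w') x = thirdCommutator w x * thirdCommutator w' x := by
  refine Subtype.ext ((commutatorElement_mul_left_eq_conj_mul (w : G) w' x).trans ?_)
  change w * (thirdCommutator w' x : G) * (w : G)⁻¹ * _ = _
  rw [conj_eq_of_central hz (thirdCommutator w' x).2, hz _ (thirdCommutator w' x).2]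
  rfl

theorem thirdCommutator_mul_right
    (hz : ∀ z ∈ thirdLCS G, ∀ g : G, z * g = g * z) (w : commutator G) (x y : G) :
    thirdCommutator w (x * y) = thirdCommutator w x * thirdCommutator w y := by
  refine Subtype.ext ?_
  have h : ⁅(w : G), x * y⁆ = ⁅(w : G), x⁆ * (x * ⁅(w : G), y⁆ * x⁻¹) := by
    simp [commutatorElement_def, mul_assoc]
  exact h.trans (congrArg _ (conj_eq_of_central hz (thirdCommutator w y).2 x))

theorem thirdCommutator_eq_one_of_mem
    (hz : ∀ z ∈ thirdLCS G, ∀ g : G, z * g = g * z)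
    {w : commutator G} (hw : (w : G) ∈ thirdLCS G) (x : G) :
    thirdCommutator w x = 1 :=
  Subtype.ext (commutatorElement_eq_one_iff_mul_comm.2 (hz _ hw x))

/-- Centrality of `G₃` removes the conjugations from the Hall–Witt identity. The inverses occur in
pairs within a term, so they cancel under multilinearity. -/
theorem thirdCommutator_hall_witt
    (hz : ∀ z ∈ thirdLCS G, ∀ g : G, z * g = g * z) (x y z : G) :
    thirdCommutator (derivedCommutator x y) z *
      thirdCommutator (derivedCommutator z⁻¹ x⁻¹) y *
        thirdCommutator (derivedCommutator y⁻¹ z) x⁻¹ = 1 := by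
  refine Subtype.ext ?_
  have hA := (thirdCommutator (derivedCommutator z⁻¹ x⁻¹) y).2
  have hB := (thirdCommutator (derivedCommutator y⁻¹ z) x⁻¹).2
  change ⁅⁅x, y⁆, z⁆ * ⁅⁅z⁻¹, x⁻¹⁆, y⁆ * ⁅⁅y⁻¹, z⁆, x⁻¹⁆ = 1
  change ⁅⁅z⁻¹, x⁻¹⁆, y⁆ ∈ thirdLCS G at hA
  change ⁅⁅y⁻¹, z⁆, x⁻¹⁆ ∈ thirdLCS G at hB
  have h : (x * z) * ⁅⁅z⁻¹, x⁻¹⁆, y⁆ * (z⁻¹ * (y * ⁅⁅y⁻¹, z⁆, x⁻¹⁆ * y⁻¹) * x⁻¹) =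
      ⁅⁅x, y⁆, z⁆⁻¹ := by
    simp only [commutatorElement_def]
    group
  generalize ⁅⁅z⁻¹, x⁻¹⁆, y⁆ = A at *
  generalize ⁅⁅y⁻¹, z⁆, x⁻¹⁆ = B at *
  rw [conj_eq_of_central hz hB, ← hz A hA, ← hz B hB] at h
  have hAB : A * B = ⁅⁅x, y⁆, z⁆⁻¹ := by
    rw [← h, mul_assoc, mul_right_inj]
    refine (conj_eq_of_central hz hB (x * z)).symm.trans ?_
    group
  rw [mul_assoc, hAB, mul_inv_cancel]

theorem thirdHoms_thirdCommutator_mul_left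
    (hz : ∀ z ∈ thirdLCS G, ∀ g : G, z * g = g * z)
    (l : thirdHoms G p) (w w' : commutator G) (x : G) :
    l.1 (thirdCommutator (w * w') x) = l.1 (thirdCommutator w x) + l.1 (thirdCommutator w' x) := by
  rw [thirdCommutator_mul_left hz, homsVanishingOn.map_mul]

theorem thirdHoms_thirdCommutator_mul_right
    (hz : ∀ z ∈ thirdLCS G, ∀ g : G, z * g = g * z)
    (l : thirdHoms G p) (w : commutator G) (x y : G) :
    l.1 (thirdCommutator w (x * y)) = l.1 (thirdCommutator w x) + l.1 (thirdCommutator w y) := by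
  rw [thirdCommutator_mul_right hz, homsVanishingOn.map_mul]

/-- For a homomorphism `l` on `G₃` and `x` in `G`, the homomorphism `w ↦ l ⁅w, x⁆` on `G'`. -/
def thirdHomsBracket
    (hz : ∀ z ∈ thirdLCS G, ∀ g : G, z * g = g * z) (l : thirdHoms G p) (x : G) : derivedHoms G p :=
  ⟨fun w => l.1 (thirdCommutator w x),
    fun w w' => thirdHoms_thirdCommutator_mul_left hz l w w' x,
    fun w hw => by
      change l.1 (thirdCommutator w x) = 0
      rw [thirdCommutator_eq_one_of_mem hz hw, homsVanishingOn.map_one]⟩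

theorem thirdHoms_eq_zero (l : thirdHoms G p) (h : ∀ w x, l.1 (thirdCommutator w x) = 0) :
    l = 0 := by
  have hle : thirdLCS G ≤ (homsVanishingOn.toHom l).ker.map (thirdLCS G).subtype := by
    refine Subgroup.commutator_le.2 fun w hw x _ => ?_
    exact ⟨thirdCommutator ⟨w, hw⟩ x, h _ _, rfl⟩
  refine Subtype.ext (funext fun z => ?_)
  obtain ⟨z', hz', heq⟩ := hle z.2
  rw [← Subtype.ext (a1 := z') (a2 := z) heq]
  exact hz'

/-- Some `φ = l ⁅·, g⁆` is nonzero on `G'` and vanishes on `G₃`; since `φ ⁅x ^ p, y⁆ = p φ ⁅x, y⁆ =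
0`, nondegeneracy puts `x ^ p` in `G'`. -/
theorem IsCaminaGroup.pow_mem_commutator
    (hz : ∀ z ∈ thirdLCS G, ∀ g : G, z * g = g * z) [Finite G] (hG : IsCaminaGroup G) (hp : p.Prime)
    (hpG : IsPGroup p G) (hne : thirdLCS G ≠ ⊥) (x : G) : x ^ p ∈ commutator G := by
  let _ : CommGroup (thirdLCS G) :=
    { (inferInstance : Group (thirdLCS G)) with
      mul_comm := fun a b => Subtype.ext (hz a a.2 b) }
  have : Nontrivial (thirdLCS G) := (Subgroup.nontrivial_iff_ne_bot _).2 hne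
  obtain ⟨l, hl⟩ := exists_ne_zero_homsVanishingOn_bot hp (hpG.to_subgroup (thirdLCS G))
  obtain ⟨w, g, hwg⟩ : ∃ w g, l.1 (thirdCommutator w g) ≠ 0 := by
    by_contra! h
    exact hl (thirdHoms_eq_zero l h)
  refine hG.mem_commutator_of_derivedHoms (φ := thirdHomsBracket hz l g)
    (fun h => hwg (congrFun (congrArg Subtype.val h) w)) fun y => ?_
  rw [derivedHoms_pow_left, ZMod.natCast_self, zero_mul]

/-- On generators, `⁅⁅x, y⁆, g⁆ ^ p = ⁅⁅x ^ p, y⁆, g⁆ = 1`, because `x ^ p ∈ G'` makes the inner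
commutator central. -/
theorem thirdLCS_pow_eq_one
    (hz : ∀ z ∈ thirdLCS G, ∀ g : G, z * g = g * z)
    (hpow : ∀ x : G, x ^ p ∈ commutator G) (z : thirdLCS G) :
    z ^ p = 1 := by
  have hcomm : ∀ a b : thirdLCS G, Commute a b := fun a b => Subtype.ext (hz a a.2 b)
  have hw : ∀ (w : G) (hw : w ∈ commutator G) (g : G), thirdCommutator ⟨w, hw⟩ g ^ p = 1 := by
    intro w hw g
    have hmap : ∀ w w', thirdCommutator (w * w') g ^ p =
        thirdCommutator w g ^ p * thirdCommutator w' g ^ p := fun w w' => by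
      rw [thirdCommutator_mul_left hz, (hcomm _ _).mul_pow]
    let f : commutator G →* thirdLCS G := MonoidHom.mk' (fun w => thirdCommutator w g ^ p)
      hmap
    have hle : commutator G ≤ f.ker.map (commutator G).subtype := by
      refine Subgroup.commutator_le.2 fun x _ y _ => ?_
      refine ⟨derivedCommutator x y, ?_, rfl⟩
      change thirdCommutator (derivedCommutator x y) g ^ p = 1
      -- The correction term `⁅u, ⁅u', y⁆⁆` lies in `G₃`, so bracketing with `g` kills it.
      have hu : ∀ u u', thirdCommutator (derivedCommutator (u * u') y) g =
          thirdCommutator (derivedCommutator u y) g *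
            thirdCommutator (derivedCommutator u' y) g := fun u u' => by
        have heq : derivedCommutator (u * u') y =
            derivedCommutator u (derivedCommutator u' y : G) *
              derivedCommutator u' y * derivedCommutator u y :=
          Subtype.ext (by simp [derivedCommutator, commutatorElement_def, mul_assoc])
        have hmem : (derivedCommutator u (derivedCommutator u' y : G) : G) ∈ thirdLCS G := by
          change ⁅u, (derivedCommutator u' y : G)⁆ ∈ thirdLCS G
          rw [← commutatorElement_inv]
          exact inv_mem (derivedCommutator_mem_thirdLCS (derivedCommutator u' y).2 u)
        rw [heq, thirdCommutator_mul_left hz, thirdCommutator_mul_left hz,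
          thirdCommutator_eq_one_of_mem hz hmem, one_mul]
        exact hcomm _ _
      let f' : G →* thirdLCS G :=
        MonoidHom.mk' (fun u => thirdCommutator (derivedCommutator u y) g) hu
      change f' x ^ p = 1
      rw [← map_pow]
      exact thirdCommutator_eq_one_of_mem hz (derivedCommutator_mem_thirdLCS (hpow x) y) g
    obtain ⟨w', hw', rfl⟩ := hle hw
    exact hw'
  let f : thirdLCS G →* thirdLCS G :=
    MonoidHom.mk' (fun z => z ^ p) fun a b => (hcomm a b).mul_pow p
  have hle : thirdLCS G ≤ f.ker.map (thirdLCS G).subtype := by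
    refine Subgroup.commutator_le.2 fun w hw' x _ => ?_
    exact ⟨thirdCommutator ⟨w, hw'⟩ x, hw w hw' x, rfl⟩
  obtain ⟨z', hz', heq⟩ := hle z.2
  rw [← Subtype.ext (a1 := z') (a2 := z) heq]
  exact hz'

theorem mem_centralizerMod_iff {N : Subgroup G} [N.Normal] {x : G} :
    x ∈ centralizerMod N ↔ ∀ w ∈ commutator G, ⁅w, x⁆ ∈ N := by
  rw [centralizerMod, Subgroup.mem_comap, Subgroup.mem_centralizer_iff]
  have h : ∀ w : G, (QuotientGroup.mk' N w * QuotientGroup.mk' N x =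
      QuotientGroup.mk' N x * QuotientGroup.mk' N w) ↔ ⁅w, x⁆ ∈ N := fun w => by
    rw [← commutatorElement_eq_one_iff_mul_comm, ← map_commutatorElement,
      QuotientGroup.mk'_apply, QuotientGroup.eq_one_iff]
  constructor
  · exact fun hx w hw => (h w).1 (hx _ ⟨w, hw, rfl⟩)
  · rintro hx _ ⟨w, hw, rfl⟩
    exact (h w).2 (hx w hw)

/-- The witness is `C(N)` for `N = ker l`, of index `p` in `G₃`. -/
theorem exists_mem_centralizerFamily_of_thirdHoms
    (hz : ∀ z ∈ thirdLCS G, ∀ g : G, z * g = g * z)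
    (hp : p.Prime) (l : thirdHoms G p) (hl : l ≠ 0) :
    ∃ C ∈ centralizerFamily G p, ∀ x, x ∈ C ↔ ∀ w, l.1 (thirdCommutator w x) = 0 := by
  let N := (homsVanishingOn.toHom l).ker.map (thirdLCS G).subtype
  have hN : N ≤ thirdLCS G := Subgroup.map_subtype_le _
  have hnormal : N.Normal := ⟨fun n hn g => by
    rwa [conj_eq_of_central hz (hN hn)]⟩
  refine ⟨centralizerMod N, ⟨N, hnormal, hN, ?_, rfl⟩, fun x => ?_⟩
  · rw [Subgroup.relIndex, Subgroup.subgroupOf,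
      Subgroup.comap_map_eq_self_of_injective (Subgroup.subtype_injective _),
      homsVanishingOn.index_ker_toHom hp l hl]
  · rw [mem_centralizerMod_iff]
    constructor
    · intro h w
      obtain ⟨z, hz, heq⟩ := h w w.2
      rw [← Subtype.ext (a1 := z) (a2 := thirdCommutator w x) heq]
      exact hz
    · intro h w hw
      exact ⟨thirdCommutator ⟨w, hw⟩ x, h _, rfl⟩

end Class3

/-! ### Assembly -/

theorem theorem4p6 {G : Type*} [Group G] [Finite G] (p : ℕ) (hp : p.Prime)
    (hpG : IsPGroup p G) (hCamina : IsCaminaGroup G) (hclass : Group.nilpotencyClass G = 3)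
    (hcent : Subgroup.centralizer (commutator G : Set G) = commutator G)
    (a : ℕ) (ha : 1 ≤ a) (hcard : (centralizerFamily G p).ncard ≤ p ^ a + 1) :
    Nat.card (thirdLCS G) ≤ p ^ (2 * a) := by
  have : Fact p.Prime := ⟨hp⟩
  have hnil : Group.IsNilpotent G := by
    by_contra h
    rw [Group.nilpotencyClass_of_not_nilpotent h] at hclass
    omega
  have h3 : ⁅thirdLCS G, (⊤ : Subgroup G)⁆ = ⊥ := by
    have := Subgroup.lowerCentralSeries_nilpotencyClass (G := G)
    rw [hclass] at this
    exact this
  have hz : ∀ z ∈ thirdLCS G, ∀ g : G, z * g = g * z := fun z hzm g => by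
    have h := Subgroup.commutator_mem_commutator hzm (Subgroup.mem_top g)
    rwa [h3, Subgroup.mem_bot, commutatorElement_eq_one_iff_mul_comm] at h
  have hne : thirdLCS G ≠ ⊥ := fun h => by
    have h2 : Group.nilpotencyClass G ≤ 2 :=
      Subgroup.lowerCentralSeries_eq_bot_iff_nilpotencyClass_le.1 h
    omega
  have hpow := hCamina.pow_mem_commutator hz hp hpG hne
  have hG3 := thirdLCS_pow_eq_one hz hpow
  let _ : CommGroup (thirdLCS G) :=
    { (inferInstance : Group (thirdLCS G)) with
      mul_comm := fun a b => Subtype.ext (hz a a.2 b) }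
  have : Module (ZMod p) (Additive (Abelianization G)) :=
    AddCommGroup.zmodModule (n := p) fun v => by
      obtain ⟨x, rfl⟩ := toAbelianization_surjective v
      exact toAbelianization_eq_zero_iff.2 (hpow x)
  have : Finite (Additive (Abelianization G)) :=
    Finite.of_surjective _ (toAbelianization_surjective (G := G))
  obtain ⟨β, hβ⟩ := exists_bilinearMap_toAbelianization (G := G) (p := p)
    (M := derivedHoms G p →ₗ[ZMod p] ZMod p)
    (fun x y => (LinearMap.proj (derivedCommutator x y)).comp (derivedHoms G p).subtype)
    (fun x y z => LinearMap.ext fun φ => derivedHoms_mul_left φ x y z)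
    (fun x y z => LinearMap.ext fun φ => derivedHoms_mul_right φ x y z)
  have hβ' : ∀ (x y : G) (φ : derivedHoms G p), β (toAbelianization x) (toAbelianization y) φ =
      φ.1 (derivedCommutator x y) := fun x y φ => LinearMap.congr_fun (hβ x y) φ
  obtain ⟨T, hT⟩ := exists_linearMap_toAbelianization (G := G) (p := p)
    (M := thirdHoms G p →ₗ[ZMod p] derivedHoms G p)
    (fun x => { toFun := fun l => thirdHomsBracket hz l x
                map_add' := fun _ _ => rfl
                map_smul' := fun _ _ => rfl })
    (fun x y => LinearMap.ext fun l => Subtype.ext (funext fun w =>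
      thirdHoms_thirdCommutator_mul_right hz l w x y))
  have hT' : ∀ (x : G) (l : thirdHoms G p) w,
      (T (toAbelianization x) l).1 w = l.1 (thirdCommutator w x) :=
    fun x l w => congrFun (congrArg Subtype.val (LinearMap.congr_fun (hT x) l)) w
  have hT0 : ∀ (x : G) (l : thirdHoms G p),
      T (toAbelianization x) l = 0 ↔ ∀ w, l.1 (thirdCommutator w x) = 0 :=
    fun x l => ⟨fun h w => by rw [← hT', h]; rfl,
      fun h => Subtype.ext (funext fun w => (hT' x l w).trans (h w))⟩
  have key := finrank_le_two_mul_of_ncard_ker_le β (fun v => ?_) (fun φ hφ v hv => ?_) T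
    (fun l u v w => ?_) (fun l hl => ?_) (fun v hv => ?_) a ?_
  · exact (card_le_pow_finrank_homsVanishingOn_bot hp hG3).trans
      (Nat.pow_le_pow_right hp.pos key)
  · obtain ⟨x, rfl⟩ := toAbelianization_surjective v
    exact LinearMap.ext fun φ => (hβ' x x φ).trans (derivedHoms_self φ x)
  · obtain ⟨x, rfl⟩ := toAbelianization_surjective v
    exact toAbelianization_eq_zero_iff.2 (hCamina.mem_commutator_of_derivedHoms hφ fun y =>
      (hβ' x y φ).symm.trans (hv _))
  · obtain ⟨x, rfl⟩ := toAbelianization_surjective u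
    obtain ⟨y, rfl⟩ := toAbelianization_surjective v
    obtain ⟨z, rfl⟩ := toAbelianization_surjective w
    have h := congrArg l.1 (thirdCommutator_hall_witt hz x y z)
    rw [homsVanishingOn.map_mul, homsVanishingOn.map_mul, homsVanishingOn.map_one,
      ← hT', ← hT', ← hT', ← hβ', ← hβ', ← hβ'] at h
    simp only [toAbelianization_inv, map_neg, LinearMap.neg_apply, neg_neg] at h
    rw [← h]
    abel
  · exact thirdHoms_eq_zero l fun w x => (hT0 x l).1 (hl _) w
  · obtain ⟨x, rfl⟩ := toAbelianization_surjective v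
    rw [toAbelianization_eq_zero_iff, ← hcent]
    refine Subgroup.mem_centralizer_iff.2 fun w hw => ?_
    rw [← commutatorElement_eq_one_iff_mul_comm]
    by_contra hne
    obtain ⟨l, hl⟩ := exists_homsVanishingOn_bot_ne_zero hp hG3
      (x := thirdCommutator ⟨w, hw⟩ x) (fun h => hne (congrArg Subtype.val h))
    exact hl ((hT0 x l).1 (hv l) _)
  · rw [Nat.card_zmod]
    refine le_trans ?_ hcard
    -- Taking preimages in `G` embeds the kernels in `V` into `𝒞(G)`; injectivity alone gives the
    -- bound.
    refine Set.ncard_le_ncard_of_injOn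
      (fun C => (AddSubgroup.toSubgroup' C.toAddSubgroup).comap Abelianization.of) ?_ ?_
      (Set.toFinite _)
    · rintro _ ⟨l, hl, rfl⟩
      obtain ⟨C, hC, hmem⟩ := exists_mem_centralizerFamily_of_thirdHoms hz hp l hl
      convert hC using 1
      ext x
      exact (hT0 x l).trans (hmem x).symm
    · intro C _ D _ h
      ext v
      obtain ⟨x, rfl⟩ := toAbelianization_surjective v
      exact SetLike.ext_iff.1 h x
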